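/- Consider a single-class G/G/1 queue with update packets $k=1,2,\dots$: the inter-arrival times $I_1,I_2,\dots$ are i.i.d. copies of $I$, the service times $X_1,X_2,\dots$ are i.i.d. copies of $X$, all these variables are mutually independent and almost surely positive, $\mathbb E[I^2]<\infty$, $\mathbb E[X^2]<\infty$, and the queue is stable: $\mathbb E[X]<\mathbb E[I]$. Put $\lambda=1/\mathbb E[I]$. Packet $k$ is generated and joins the queue at time $S_k=I_1+\dots+I_k$; packets are served first-come-first-served by one server with unlimited buffer, so packet $k$ is received at time $D_k=\max(D_{k-1},S_k)+X_k$, where $D_0\ge 0$ is an arbitrary (possibly random) initial backlog. The status age at time $t\ge0$ is $\Delta(t)=t-u(t)$, where $u(t)$ is the generation time of the latest packet received by time $t$ (and $u(t)=-a_0$, with $a_0\ge0$ an arbitrary, possibly random, initial age, if no packet has been received by time $t$). Let $A_k=\Delta(D_k^-)$ be the $k$-th peak of the age, i.e. its value just before packet $k$ is received. Then the average age of information and the peak age of information $$A_{av}=\lim_{T\to\infty}\frac1T\int_0^T\Delta(t)\,dt,\qquad A_p=\lim_{K\to\infty}\frac1K\sum_{k=1}^K A_k$$ exist almost surely as finite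 constants that do not depend on the sample path, and $$A_p-\frac{3\lambda\,\mathbb E[I^2]}{2}-\lambda\,\mathbb E[I]^2\;\le\; A_{av}\;\le\; A_p+\frac{\lambda\,\mathbb E[I^2]}{2},$$ where $\mathbb E[I]^2=(\mathbb E[I])^2$. -/

import Mathlib

open MeasureTheory ProbabilityTheory Filter Topology

namespace GG1

/-- The primitive data of a single-class G/G/1 queue: packet `k` arrives `I k` time units after
packet `k - 1` (packet `0` arrives `I 0` time units after time `0`) and requires service `X k`.
The inter-arrival times are i.i.d., the service times are i.i.d., all of them are mutually
independent, and they are almost surely positive. -/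
structure IsInput {Ω : Type*} [MeasurableSpace Ω] (μ : Measure Ω) (I X : ℕ → Ω → ℝ) : Prop where
  measurable_interarrival : ∀ k, Measurable (I k)
  measurable_service : ∀ k, Measurable (X k)
  indep : iIndepFun (Sum.elim I X) μ
  ident_interarrival : ∀ k, IdentDistrib (I k) (I 0) μ μ
  ident_service : ∀ k, IdentDistrib (X k) (X 0) μ μ
  interarrival_pos : ∀ᵐ ω ∂μ, 0 < I 0 ω
  service_pos : ∀ᵐ ω ∂μ, 0 < X 0 ω

/-- Generation (arrival) time of packet `k`, for a path `i` of inter-arrival times. -/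
def arrival (i : ℕ → ℝ) (k : ℕ) : ℝ := ∑ j ∈ Finset.range (k + 1), i j

/-- Reception (departure) time of packet `k` in the work-conserving first-come-first-served
single-server queue with unlimited buffer; the server is busy with the backlog `w₀` found at
time `0` until time `w₀`. A packet enters service once it has arrived and the previous one has
left. -/
noncomputable def departure (w₀ : ℝ) (i x : ℕ → ℝ) : ℕ → ℝ
  | 0 => max w₀ (arrival i 0) + x 0
  | k + 1 => max (departure w₀ i x k) (arrival i (k + 1)) + x (k + 1)

/-- Generation time of the latest update received by time `t`; the update known at time `0` was
generated at time `-a₀`. -/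
noncomputable def lastGenerated (w₀ a₀ : ℝ) (i x : ℕ → ℝ) (t : ℝ) : ℝ :=
  sSup (insert (-a₀) {s : ℝ | ∃ k : ℕ, departure w₀ i x k ≤ t ∧ s = arrival i k})

/-- The status age `Δ(t)`: time elapsed since the latest received update was generated. -/
noncomputable def age (w₀ a₀ : ℝ) (i x : ℕ → ℝ) (t : ℝ) : ℝ :=
  t - lastGenerated w₀ a₀ i x t

/-- The peak of the age that ends with the reception of packet `k`: the value of the age just
before that reception. -/
noncomputable def peak (w₀ a₀ : ℝ) (i x : ℕ → ℝ) (k : ℕ) : ℝ :=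
  Function.leftLim (age w₀ a₀ i x) (departure w₀ i x k)

/-- `a` is the average age `lim_{T → ∞} (1/T) ∫_0^T Δ(t) dt` of the path. -/
def HasAverageAge (w₀ a₀ : ℝ) (i x : ℕ → ℝ) (a : ℝ) : Prop :=
  (∀ T : ℝ, 0 ≤ T → IntervalIntegrable (age w₀ a₀ i x) volume 0 T) ∧
    Tendsto (fun T : ℝ => (1 / T) * ∫ t in (0 : ℝ)..T, age w₀ a₀ i x t) atTop (𝓝 a)

/-- `a` is the average peak age `lim_{K → ∞} (1/K) ∑ A_k` (first `K` peaks) of the path. -/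
def HasPeakAge (w₀ a₀ : ℝ) (i x : ℕ → ℝ) (a : ℝ) : Prop :=
  Tendsto (fun K : ℕ => (1 / (K : ℝ)) * ∑ k ∈ Finset.range K, peak w₀ a₀ i x k) atTop (𝓝 a)

end GG1

/-! Packet sojourn times obey the Lindley recursion `step`. Loynes' backward construction gives a
stationary law `statLaw`; comparing second moments across one step shows that its mean τ is finite.
Coalescence of paths makes the stationary queue ergodic and lets Birkhoff averages be taken from any
initial state (`ae_tendsto_average`).

A peak is a sojourn plus an inter-arrival time, so A_p = τ + E[I]. The age integral between
receptions is a trapezoid, so A_av = β / E[I] with β the mean `area`. Up to the coboundary of u²/2,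
that area is W'I + I²/2, where W' = `step` u (I, X) is the new sojourn time. The coboundary has mean
zero even if u² is not integrable, so β = E[W'I] + E[I²]/2.

The previous sojourn u is independent of I, and u - I + X ≤ W' ≤ u + X. Hence τE[I] - E[I²] ≤ E[W'I]
≤ τE[I] + E[I]E[X]. With E[X] < E[I] both bounds follow. -/

namespace ErgodicAverage

/-! ### Maximal sums and the pointwise ergodic theorem. -/

section Pointwise

variable {α : Type*} {T : α → α} {f : α → ℝ}

/-- The running maximum of the Birkhoff sums of `f`, defined through its recursion. -/
noncomputable def maxSum (T : α → α) (f : α → ℝ) : ℕ → α → ℝ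
  | 0 => fun _ => 0
  | n + 1 => fun x => max 0 (f x + maxSum T f n (T x))

lemma maxSum_nonneg (n : ℕ) (x : α) : 0 ≤ maxSum T f n x := by
  cases n with
  | zero => exact le_rfl
  | succ n => exact le_max_left _ _

lemma maxSum_le_succ (n : ℕ) (x : α) : maxSum T f n x ≤ maxSum T f (n + 1) x := by
  induction n generalizing x with
  | zero => exact maxSum_nonneg 1 x
  | succ n ih => exact max_le_max le_rfl (by gcongr; exact ih (T x))

lemma monotone_maxSum (x : α) : Monotone fun n => maxSum T f n x :=
  monotone_nat_of_le_succ fun n => maxSum_le_succ n x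

lemma birkhoffSum_le_maxSum (n : ℕ) (x : α) : birkhoffSum T f n x ≤ maxSum T f n x := by
  induction n generalizing x with
  | zero => simp [maxSum]
  | succ n ih =>
    rw [birkhoffSum_succ']
    exact le_max_of_le_right (by gcongr; exact ih (T x))

/-- One step of the recursion changes a bound by a finite amount only, so the set where the maximal
sums stay bounded is strictly invariant and ergodicity applies to it. -/
lemma bddAbove_maxSum_comp_iff (x : α) :
    BddAbove (Set.range fun n => maxSum T f n (T x)) ↔
      BddAbove (Set.range fun n => maxSum T f n x) := by
  constructor
  · rintro ⟨C, hC⟩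
    refine ⟨max 0 (f x + C), ?_⟩
    rintro _ ⟨n, rfl⟩
    refine (maxSum_le_succ n x).trans (max_le_max le_rfl ?_)
    gcongr
    exact hC ⟨n, rfl⟩
  · rintro ⟨C, hC⟩
    refine ⟨C - f x, ?_⟩
    rintro _ ⟨n, rfl⟩
    have h1 : maxSum T f (n + 1) x ≤ C := hC ⟨n + 1, rfl⟩
    have h2 : f x + maxSum T f n (T x) ≤ maxSum T f (n + 1) x := le_max_right _ _
    simp only
    linarith

end Pointwise

variable {α : Type*} [MeasurableSpace α] {μ : Measure α} {T : α → α} {f : α → ℝ}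

lemma measurable_maxSum (hT : Measurable T) (hf : Measurable f) (n : ℕ) :
    Measurable (maxSum T f n) := by
  induction n with
  | zero => exact measurable_const
  | succ n ih => exact measurable_const.max (hf.add (ih.comp hT))

lemma integrable_maxSum (hT : MeasurePreserving T μ μ) (hf : Integrable f μ) (n : ℕ) :
    Integrable (maxSum T f n) μ := by
  induction n with
  | zero => exact integrable_zero _ _ _
  | succ n ih => exact (integrable_zero _ _ _).sup (hf.add (hT.integrable_comp_of_integrable ih))

/-- Garsia's argument: M_{n+1} - M_n ∘ T equals max (-M_n ∘ T) f, which is dominated by |f| and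
eventually equals f where M_n is unbounded. Its integral is nonnegative because M_n increases with n
and T preserves μ. -/
lemma integral_nonneg_of_ae_unbounded (hT : MeasurePreserving T μ μ) (hf : Integrable f μ)
    (hub : ∀ᵐ x ∂μ, ¬ BddAbove (Set.range fun n => maxSum T f n x)) : 0 ≤ ∫ x, f x ∂μ := by
  have hlim : Tendsto (fun n => ∫ x, (maxSum T f (n + 1) x - maxSum T f n (T x)) ∂μ) atTop
      (𝓝 (∫ x, f x ∂μ)) := by
    refine tendsto_integral_of_dominated_convergence (fun x => |f x|) (fun n => ?_) hf.abs
      (fun n => ?_) ?_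
    · exact ((integrable_maxSum hT hf _).sub
        (hT.integrable_comp_of_integrable (integrable_maxSum hT hf n))).aestronglyMeasurable
    · refine ae_of_all _ fun x => ?_
      have h0 := maxSum_nonneg (T := T) (f := f) n (T x)
      rw [Real.norm_eq_abs, maxSum, abs_le]
      constructor
      · linarith [le_max_right 0 (f x + maxSum T f n (T x)), neg_abs_le (f x)]
      · rw [sub_le_iff_le_add]
        exact max_le (by positivity) (by linarith [le_abs_self (f x)])
    · filter_upwards [hub] with x hx
      rw [← bddAbove_maxSum_comp_iff] at hx
      refine tendsto_const_nhds.congr' ?_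
      filter_upwards [((monotone_maxSum (T x)).tendsto_atTop_atTop
        (fun b => by
          by_contra! h
          exact hx ⟨b, by rintro _ ⟨n, rfl⟩; exact (h n).le⟩)).eventually_ge_atTop (-f x)]
        with n hn
      have h : maxSum T f (n + 1) x = f x + maxSum T f n (T x) := max_eq_right (by linarith)
      simp only [h, add_sub_cancel_right]
  refine ge_of_tendsto' hlim fun n => ?_
  rw [integral_sub (g := fun x => maxSum T f n (T x)) (integrable_maxSum hT hf _)
    (hT.integrable_comp_of_integrable (integrable_maxSum hT hf n)), sub_nonneg,
    show ∫ x, maxSum T f n (T x) ∂μ = ∫ x, maxSum T f n x ∂μ from ?_]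
  · exact integral_mono (integrable_maxSum hT hf _) (integrable_maxSum hT hf _)
      fun x => maxSum_le_succ n x
  · have h := (integrable_maxSum hT hf n).aestronglyMeasurable
    rw [← hT.map_eq] at h
    rw [← integral_map hT.measurable.aemeasurable h, hT.map_eq]

lemma ae_bddAbove_birkhoffSum (hT : Ergodic T μ) (hfm : Measurable f) (hf : Integrable f μ)
    (hneg : ∫ x, f x ∂μ < 0) :
    ∀ᵐ x ∂μ, BddAbove (Set.range fun n => birkhoffSum T f n x) := by
  have hms : MeasurableSet {x | BddAbove (Set.range fun n => maxSum T f n x)} :=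
    measurableSet_bddAbove_range fun n => measurable_maxSum hT.measurable hfm n
  rcases hT.ae_mem_or_ae_notMem hms
    (by ext x; exact bddAbove_maxSum_comp_iff x) with h | h
  · filter_upwards [h] with x ⟨C, hC⟩
    refine ⟨C, ?_⟩
    rintro _ ⟨n, rfl⟩
    exact (birkhoffSum_le_maxSum n x).trans (hC ⟨n, rfl⟩)
  · exact absurd (integral_nonneg_of_ae_unbounded hT.toMeasurePreserving hf h) hneg.not_ge

lemma ae_eventually_birkhoffSum_div_lt [IsProbabilityMeasure μ] (hT : Ergodic T μ)
    (hfm : Measurable f) (hf : Integrable f μ) :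
    ∀ᵐ x ∂μ, ∀ c, ∫ y, f y ∂μ < c → ∀ᶠ n : ℕ in atTop, birkhoffSum T f n x / n < c := by
  -- Rational levels keep the exceptional set null; bounded sums of f - q force limsup ≤ q.
  have key : ∀ᵐ x ∂μ, ∀ q : ℚ, ∫ y, f y ∂μ < q →
      BddAbove (Set.range fun n => birkhoffSum T (fun y => f y - q) n x) := by
    refine ae_all_iff.2 fun q => ?_
    by_cases hq : ∫ y, f y ∂μ < q
    · filter_upwards [ae_bddAbove_birkhoffSum hT (hfm.sub_const (q : ℝ))
        (hf.sub (integrable_const _)) (by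
          rw [integral_sub hf (integrable_const _)]; simpa using hq)] with x hx _ using hx
    · exact ae_of_all _ fun x h => absurd h hq
  filter_upwards [key] with x hx c hc
  obtain ⟨q, hq, hqc⟩ := exists_rat_btwn hc
  obtain ⟨C, hC⟩ := hx q hq
  have hlim : Tendsto (fun n : ℕ => C / (n : ℝ)) atTop (𝓝 0) :=
    tendsto_const_div_atTop_nhds_zero_nat C
  filter_upwards [hlim.eventually_lt_const (sub_pos.2 hqc), eventually_gt_atTop 0] with n hn hn0
  have h1 : birkhoffSum T (fun y => f y - q) n x ≤ C := hC ⟨n, rfl⟩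
  have h2 : birkhoffSum T (fun y => f y - q) n x = birkhoffSum T f n x - n * q := by
    simp [birkhoffSum, Finset.sum_sub_distrib]
  have hn' : (0 : ℝ) < n := by exact_mod_cast hn0
  rw [div_lt_iff₀ hn'] at hn ⊢
  nlinarith

/-- **Birkhoff's pointwise ergodic theorem** for ergodic maps of a probability space. -/
theorem tendsto_birkhoffSum_div [IsProbabilityMeasure μ] (hT : Ergodic T μ)
    (hfm : Measurable f) (hf : Integrable f μ) :
    ∀ᵐ x ∂μ, Tendsto (fun n : ℕ => birkhoffSum T f n x / n) atTop (𝓝 (∫ y, f y ∂μ)) := by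
  filter_upwards [ae_eventually_birkhoffSum_div_lt hT hfm hf,
    ae_eventually_birkhoffSum_div_lt hT hfm.neg hf.neg] with x h1 h2
  refine tendsto_order.2 ⟨fun c hc => ?_, h1⟩
  filter_upwards [h2 (-c) (by rw [integral_neg']; linarith)] with n hn
  have : birkhoffSum T (-f) n x = - birkhoffSum T f n x := by simp [birkhoffSum]
  rw [this, neg_div] at hn
  linarith

/-- An integrable coboundary has integral zero, even if its potential is not integrable. -/
lemma integral_comp_sub_eq_zero [IsProbabilityMeasure μ] (hT : Ergodic T μ) {g : α → ℝ}
    (hg : Measurable g) (hint : Integrable (fun x => g (T x) - g x) μ) :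
    ∫ x, (g (T x) - g x) ∂μ = 0 := by
  -- By Poincaré recurrence some orbit returns infinitely often to this set. At those times the
  -- telescoped sum is at most 2N in absolute value, so the Birkhoff limit can only be zero.
  obtain ⟨N, hN⟩ : ∃ N : ℕ, μ {x | |g x| ≤ N} ≠ 0 := by
    by_contra! h
    have : μ (⋃ N : ℕ, {x | |g x| ≤ N}) = 0 := measure_iUnion_null h
    rw [show (⋃ N : ℕ, {x | |g x| ≤ N}) = Set.univ from
      Set.eq_univ_of_forall fun x => Set.mem_iUnion.2 (exists_nat_ge |g x|)] at this
    simp at this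
  have hs : MeasurableSet {x | |g x| ≤ N} := measurableSet_le hg.abs measurable_const
  obtain ⟨x, ⟨hx, hfreq⟩, hlim⟩ :=
    ((hT.toMeasurePreserving.conservative.frequently_ae_mem_and_frequently_image_mem
      hs.nullMeasurableSet hN).and_eventually
      (tendsto_birkhoffSum_div hT ((hg.comp hT.measurable).sub hg) hint)).exists
  have hsum : ∀ n, birkhoffSum T (fun x => g (T x) - g x) n x = g (T^[n] x) - g x := by
    intro n
    induction n with
    | zero => simp
    | succ n ih =>
      rw [birkhoffSum_succ, ih, Function.iterate_succ_apply' T n x]; ring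
  change |g x| ≤ N at hx
  have hzero : Tendsto (fun n : ℕ => (2 * N : ℝ) / (n : ℝ)) atTop (𝓝 0) :=
    tendsto_const_div_atTop_nhds_zero_nat _
  by_contra hne
  set c := ∫ x, (g (T x) - g x) ∂μ
  have hd : Tendsto (fun n : ℕ => |birkhoffSum T (fun x => g (T x) - g x) n x / n| -
      (2 * N : ℝ) / (n : ℝ)) atTop (𝓝 (|c| - 0)) := hlim.abs.sub hzero
  obtain ⟨n, hn, hpos⟩ := (hfreq.and_eventually
    (hd.eventually_const_lt (u := 0) (by simpa using hne))).exists
  change |g (T^[n] x)| ≤ N at hn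
  rw [hsum, abs_div, Nat.abs_cast, ← sub_div] at hpos
  have : |g (T^[n] x) - g x| ≤ 2 * N := (abs_sub _ _).trans (by linarith)
  exact hpos.not_ge (div_nonpos_of_nonpos_of_nonneg (by linarith) (by positivity))

end ErgodicAverage

/-! ### The shift on i.i.d. sequences. -/

namespace Shift

variable {E : Type*}

/-- The one-sided shift. -/
def shift (ω : ℕ → E) : ℕ → E := fun n => ω (n + 1)

lemma shift_iterate_apply (n k : ℕ) (ω : ℕ → E) : shift^[n] ω k = ω (n + k) := by
  induction n generalizing k with
  | zero => simp
  | succ n ih =>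
    rw [Function.iterate_succ_apply', shift, ih]
    congr 1
    omega

variable [MeasurableSpace E] (ν : Measure E) [IsProbabilityMeasure ν]

/-- The law of an i.i.d. sequence with marginal law `ν`. -/
noncomputable abbrev seqLaw : Measure (ℕ → E) := Measure.infinitePi fun _ : ℕ => ν

lemma measurable_shift : Measurable (shift : (ℕ → E) → ℕ → E) :=
  measurable_pi_lambda _ fun n => measurable_pi_apply (n + 1)

lemma measurePreserving_shift : MeasurePreserving shift (seqLaw ν) (seqLaw ν) where
  measurable := measurable_shift
  map_eq := Measure.map_infinitePi_infinitePi_of_inj (P := fun _ : ℕ => ν) Nat.succ_injective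

lemma measurePreserving_apply (n : ℕ) : MeasurePreserving (fun ω : ℕ → E => ω n) (seqLaw ν) ν where
  measurable := measurable_pi_apply n
  map_eq := Measure.infinitePi_map_eval (fun _ : ℕ => ν) n

lemma iIndep_coordinates :
    iIndep (fun n => MeasurableSpace.comap (fun ω : ℕ → E => ω n) inferInstance) (seqLaw ν) :=
  iIndepFun.iIndep (iIndepFun_infinitePi (P := fun _ : ℕ => ν) (X := fun _ x => x)
    fun _ => measurable_id)

lemma indepFun_zero_shift : IndepFun (fun ω : ℕ → E => ω 0) shift (seqLaw ν) := by
  have h := indep_iSup_of_disjoint (S := {0}) (T := {n | 1 ≤ n})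
    (fun n => (measurable_pi_apply n).comap_le) (iIndep_coordinates ν) (by simp)
  refine indep_of_indep_of_le_left (indep_of_indep_of_le_right h ?_) ?_
  · rw [MeasurableSpace.pi, MeasurableSpace.comap_iSup]
    refine iSup_le fun n => ?_
    rw [MeasurableSpace.comap_comp]
    exact le_iSup₂_of_le (n + 1) (by simp) le_rfl
  · exact le_iSup₂_of_le 0 rfl le_rfl

lemma measurePreserving_zero_shift :
    MeasurePreserving (fun ω : ℕ → E => (ω 0, shift ω)) (seqLaw ν) (ν.prod (seqLaw ν)) where
  measurable := (measurable_pi_apply 0).prodMk measurable_shift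
  map_eq := by
    rw [(indepFun_iff_map_prod_eq_prod_map_map (measurable_pi_apply 0).aemeasurable
      measurable_shift.aemeasurable).1 (indepFun_zero_shift ν),
      (measurePreserving_apply ν 0).map_eq, (measurePreserving_shift ν).map_eq]

/-- The shift of an i.i.d. sequence is ergodic. -/
lemma ergodic_shift : Ergodic shift (seqLaw ν) := by
  refine ⟨measurePreserving_shift ν, ⟨fun s hs hinv => ?_⟩⟩
  have htail : MeasurableSet[limsup
      (fun n => MeasurableSpace.comap (fun ω : ℕ → E => ω n) inferInstance) atTop] s := by
    rw [limsup_eq_iInf_iSup_of_nat, MeasurableSpace.measurableSet_iInf]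
    intro n
    -- An invariant set depends only on coordinates from n on, for every n; it is a tail event, and
    -- Kolmogorov's zero-one law applies.
    have hn : shift^[n] ⁻¹' s = s := by
      induction n with
      | zero => rfl
      | succ n ih => rw [Function.iterate_succ', Set.preimage_comp, hinv, ih]
    have hmeas : Measurable[⨆ i ≥ n, MeasurableSpace.comap (fun ω : ℕ → E => ω i) inferInstance]
        (shift^[n] : (ℕ → E) → ℕ → E) := by
      refine @measurable_pi_lambda _ _ _ (_) _ _ fun k => ?_
      simp_rw [shift_iterate_apply]
      exact (comap_measurable (fun ω : ℕ → E => ω (n + k))).mono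
        (le_iSup₂_of_le (n + k) (Nat.le_add_right n k) le_rfl) le_rfl
    rw [← hn]
    exact hmeas hs
  rw [eventuallyConst_set']
  rcases measure_zero_or_one_of_measurableSet_limsup_atTop
    (fun n => (measurable_pi_apply n).comap_le) (iIndep_coordinates ν) htail with h | h
  · exact Or.inl (ae_eq_empty.2 h)
  · exact Or.inr ((prob_compl_eq_zero_iff hs).2 h |> ae_eq_univ.2)

end Shift

/-! ### The Lindley recursion, its stationary law and its ergodicity. -/

namespace Lindley

open Shift ErgodicAverage

/-- One step of the Lindley recursion for the sojourn times: if a customer spends time `u` in the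
system and the next one arrives `e.1` later with service time `e.2`, the latter spends time
`step u e` in the system. -/
noncomputable def step (u : ℝ) (e : ℝ × ℝ) : ℝ := max (u - e.1) 0 + e.2

lemma measurable_step : Measurable fun p : ℝ × (ℝ × ℝ) => step p.1 p.2 := by
  unfold step; fun_prop

lemma continuous_step (e : ℝ × ℝ) : Continuous fun u => step u e := by
  unfold step; fun_prop

lemma step_mono {u v : ℝ} (h : u ≤ v) (e : ℝ × ℝ) : step u e ≤ step v e := by
  unfold step; gcongr

lemma le_step (u : ℝ) (e : ℝ × ℝ) : u - e.1 + e.2 ≤ step u e := by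
  unfold step; gcongr; exact le_max_left _ _

lemma step_nonneg {e : ℝ × ℝ} (he : 0 ≤ e.2) (u : ℝ) : 0 ≤ step u e :=
  add_nonneg (le_max_right _ _) he

lemma step_le {u : ℝ} {e : ℝ × ℝ} (hu : 0 ≤ u) (h1 : 0 ≤ e.1) : step u e ≤ u + e.2 := by
  unfold step; gcongr; exact max_le (by linarith) hu

lemma step_sq_le {u : ℝ} {e : ℝ × ℝ} (hu : 0 ≤ u) (h1 : 0 ≤ e.1) (h2 : 0 ≤ e.2) :
    step u e ^ 2 ≤ u ^ 2 - 2 * u * (e.1 - e.2) + (e.1 ^ 2 + e.2 ^ 2) := by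
  unfold step
  rcases le_total (u - e.1) 0 with h | h
  · rw [max_eq_right h]; nlinarith [sq_nonneg (u - e.1), mul_nonneg hu h2]
  · rw [max_eq_left h]; nlinarith [mul_nonneg h1 h2]

/-- Conditions on the joint law of an inter-arrival time and a service time. -/
structure IsStable (ν : Measure (ℝ × ℝ)) : Prop where
  fst_pos : ∀ᵐ e ∂ν, 0 < e.1
  snd_pos : ∀ᵐ e ∂ν, 0 < e.2
  memLp_fst : MemLp (fun e : ℝ × ℝ => e.1) 2 ν
  memLp_snd : MemLp (fun e : ℝ × ℝ => e.2) 2 ν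
  integral_lt : ∫ e, e.2 ∂ν < ∫ e, e.1 ∂ν
  integral_mul : ∫ e, e.1 * e.2 ∂ν = (∫ e, e.1 ∂ν) * ∫ e, e.2 ∂ν

/-- The sojourn times of the recursion started from `0`, run on the time-reversed input. -/
noncomputable def backward : ℕ → (ℕ → ℝ × ℝ) → ℝ
  | 0 => fun _ => 0
  | n + 1 => fun ω => step (backward n (shift ω)) (ω 0)

/-- Loynes' stationary sojourn time. -/
noncomputable def loynes (ω : ℕ → ℝ × ℝ) : ℝ := ⨆ n, backward n ω

lemma measurable_backward (n : ℕ) : Measurable (backward n) := by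
  induction n with
  | zero => exact measurable_const
  | succ n ih =>
    exact measurable_step.comp ((ih.comp measurable_shift).prodMk (measurable_pi_apply 0))

lemma measurable_loynes : Measurable loynes := Measurable.iSup measurable_backward

lemma backward_nonneg {ω : ℕ → ℝ × ℝ} (h : ∀ k, 0 < (ω k).1 ∧ 0 < (ω k).2) (n : ℕ) :
    0 ≤ backward n ω := by
  cases n with
  | zero => exact le_rfl
  | succ n => exact step_nonneg (h 0).2.le _

/-- Coordinate 0 is the most recent input, so increasing n moves the empty start further into the
past; the state found at the old start is then nonnegative instead of zero. -/
lemma backward_le_succ {ω : ℕ → ℝ × ℝ} (h : ∀ k, 0 < (ω k).1 ∧ 0 < (ω k).2) (n : ℕ) :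
    backward n ω ≤ backward (n + 1) ω := by
  induction n generalizing ω with
  | zero => exact backward_nonneg h 1
  | succ n ih => exact step_mono (ih fun k => h (k + 1)) _

lemma monotone_backward {ω : ℕ → ℝ × ℝ} (h : ∀ k, 0 < (ω k).1 ∧ 0 < (ω k).2) :
    Monotone fun n => backward n ω :=
  monotone_nat_of_le_succ fun n => backward_le_succ h n

section Law

variable {ν : Measure (ℝ × ℝ)} [IsProbabilityMeasure ν]

lemma IsStable.ae_pos (hν : IsStable ν) : ∀ᵐ ω ∂(seqLaw ν), ∀ k, 0 < (ω k).1 ∧ 0 < (ω k).2 :=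
  ae_all_iff.2 fun k =>
    (measurePreserving_apply ν k).quasiMeasurePreserving.ae (hν.fst_pos.and hν.snd_pos)

lemma integral_comp_of_measurePreserving {α β : Type*} [MeasurableSpace α] [MeasurableSpace β]
    {μ : Measure α} {μ' : Measure β} {g : α → β} (hg : MeasurePreserving g μ μ') {f : β → ℝ}
    (hf : Measurable f) : ∫ x, f (g x) ∂μ = ∫ y, f y ∂μ' := by
  rw [← hg.map_eq, integral_map hg.measurable.aemeasurable hf.aestronglyMeasurable]

lemma memLp_backward (hν : IsStable ν) (n : ℕ) : MemLp (backward n) 2 (seqLaw ν) := by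
  induction n with
  | zero => exact MemLp.zero
  | succ n ih =>
    refine ((ih.comp_measurePreserving (measurePreserving_shift ν)).add
      (hν.memLp_snd.comp_measurePreserving (measurePreserving_apply ν 0))).mono
      (measurable_backward _).aestronglyMeasurable ?_
    filter_upwards [hν.ae_pos] with ω hω
    rw [Real.norm_of_nonneg (backward_nonneg hω _)]
    exact (step_le (backward_nonneg (fun k => hω (k + 1)) n) (hω 0).1.le).trans (le_abs_self _)

/-- The mean of the sojourn time is bounded by comparing second moments in the recursion. -/
lemma integral_backward_le (hν : IsStable ν) (n : ℕ) :
    ∫ ω, backward n ω ∂(seqLaw ν) ≤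
      (∫ e, (e.1 ^ 2 + e.2 ^ 2) ∂ν) / (2 * (∫ e, e.1 ∂ν - ∫ e, e.2 ∂ν)) := by
  have hpos : 0 < 2 * (∫ e, e.1 ∂ν - ∫ e, e.2 ∂ν) := by linarith [hν.integral_lt]
  rw [le_div_iff₀ hpos]
  have hS := measurePreserving_shift ν
  have h0 := measurePreserving_apply ν 0
  have hB := memLp_backward hν n
  have hBs : MemLp (fun ω => backward n (shift ω)) 2 (seqLaw ν) := hB.comp_measurePreserving hS
  have h12 : MemLp (fun ω : ℕ → ℝ × ℝ => (ω 0).1 - (ω 0).2) 2 (seqLaw ν) :=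
    (hν.memLp_fst.sub hν.memLp_snd).comp_measurePreserving h0
  have hsq : Integrable (fun e : ℝ × ℝ => e.1 ^ 2 + e.2 ^ 2) ν :=
    hν.memLp_fst.integrable_sq.add hν.memLp_snd.integrable_sq
  have hsq0 : Integrable (fun ω : ℕ → ℝ × ℝ => (ω 0).1 ^ 2 + (ω 0).2 ^ 2) (seqLaw ν) :=
    h0.integrable_comp_of_integrable hsq
  have hprod : Integrable (fun ω : ℕ → ℝ × ℝ => 2 * backward n (shift ω) * ((ω 0).1 - (ω 0).2))
      (seqLaw ν) := by
    simpa only [mul_assoc] using! (hBs.integrable_mul h12).const_mul 2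
  -- Monotonicity gives E[W_n²] ≤ E[W_{n+1}²], while `step_sq_le` and independence bound the latter
  -- by E[W_n²] - 2 E[W_n] E[I - X] + E[I² + X²]. Cancelling the finite E[W_n²] bounds E[W_n].
  have h1 : ∫ ω, backward n ω ^ 2 ∂(seqLaw ν) ≤ ∫ ω, backward (n + 1) ω ^ 2 ∂(seqLaw ν) := by
    refine integral_mono_ae hB.integrable_sq (memLp_backward hν (n + 1)).integrable_sq ?_
    filter_upwards [hν.ae_pos] with ω hω
    exact pow_le_pow_left₀ (backward_nonneg hω n) (backward_le_succ hω n) 2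
  have h2 : ∫ ω, backward (n + 1) ω ^ 2 ∂(seqLaw ν) ≤
      ∫ ω, (backward n (shift ω) ^ 2 - 2 * backward n (shift ω) * ((ω 0).1 - (ω 0).2)
        + ((ω 0).1 ^ 2 + (ω 0).2 ^ 2)) ∂(seqLaw ν) := by
    refine integral_mono_ae (memLp_backward hν (n + 1)).integrable_sq
      ((hBs.integrable_sq.sub hprod).add hsq0) ?_
    filter_upwards [hν.ae_pos] with ω hω
    exact step_sq_le (backward_nonneg (fun k => hω (k + 1)) n) (hω 0).1.le (hω 0).2.le
  have hindep : ∫ ω, 2 * backward n (shift ω) * ((ω 0).1 - (ω 0).2) ∂(seqLaw ν) =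
      2 * (∫ ω, backward n ω ∂(seqLaw ν)) * (∫ e, e.1 ∂ν - ∫ e, e.2 ∂ν) := by
    rw [integral_comp_of_measurePreserving (measurePreserving_zero_shift ν)
      (f := fun p => 2 * backward n p.2 * (p.1.1 - p.1.2))
      (by have := measurable_backward n; fun_prop),
      ← integral_sub (hν.memLp_fst.integrable one_le_two) (hν.memLp_snd.integrable one_le_two)]
    rw [integral_congr_ae (g := fun p : (ℝ × ℝ) × (ℕ → ℝ × ℝ) =>
      (p.1.1 - p.1.2) * (2 * backward n p.2)) (ae_of_all _ fun p => mul_comm _ _),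
      integral_prod_mul (fun e : ℝ × ℝ => e.1 - e.2) (fun ω => 2 * backward n ω),
      integral_const_mul]
    ring
  rw [integral_add (f := fun ω => backward n (shift ω) ^ 2 -
      2 * backward n (shift ω) * ((ω 0).1 - (ω 0).2)) (hBs.integrable_sq.sub hprod) hsq0,
    integral_sub hBs.integrable_sq hprod, hindep,
    integral_comp_of_measurePreserving hS (f := fun ω => backward n ω ^ 2)
      ((measurable_backward n).pow_const 2),
    integral_comp_of_measurePreserving h0 (f := fun e : ℝ × ℝ => e.1 ^ 2 + e.2 ^ 2)
      (by fun_prop)] at h2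
  linarith

/-- Monotone convergence with the uniform mean bound. The supremum is taken in `ENNReal`, since the
real `⨆` would return 0 on unbounded families and hide divergence. -/
lemma lintegral_iSup_backward_lt_top (hν : IsStable ν) :
    ∫⁻ ω, ⨆ n, ENNReal.ofReal (backward n ω) ∂(seqLaw ν) < ⊤ := by
  rw [lintegral_iSup' (fun n => (measurable_backward n).ennreal_ofReal.aemeasurable)
    (hν.ae_pos.mono fun ω hω n m hnm => ENNReal.ofReal_le_ofReal (monotone_backward hω hnm))]
  refine (iSup_le fun n => ?_).trans_lt (ENNReal.ofReal_lt_top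
    (r := (∫ e, (e.1 ^ 2 + e.2 ^ 2) ∂ν) / (2 * (∫ e, e.1 ∂ν - ∫ e, e.2 ∂ν))))
  rw [← ofReal_integral_eq_lintegral_ofReal ((memLp_backward hν n).integrable one_le_two)
    (hν.ae_pos.mono fun ω hω => backward_nonneg hω n)]
  exact ENNReal.ofReal_le_ofReal (integral_backward_le hν n)

lemma ae_tendsto_backward (hν : IsStable ν) :
    ∀ᵐ ω ∂(seqLaw ν), Tendsto (fun n => backward n ω) atTop (𝓝 (loynes ω)) := by
  filter_upwards [hν.ae_pos, ae_lt_top (Measurable.iSup fun n =>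
    (measurable_backward n).ennreal_ofReal) (lintegral_iSup_backward_lt_top hν).ne] with ω hω hfin
  refine tendsto_atTop_ciSup (monotone_backward hω)
    ⟨(⨆ n, ENNReal.ofReal (backward n ω)).toReal, ?_⟩
  rintro _ ⟨n, rfl⟩
  rw [← ENNReal.ofReal_le_iff_le_toReal hfin.ne]
  exact le_iSup (fun n => ENNReal.ofReal (backward n ω)) n

lemma ae_loynes_nonneg (hν : IsStable ν) : ∀ᵐ ω ∂(seqLaw ν), 0 ≤ loynes ω := by
  filter_upwards [hν.ae_pos] with ω hω using Real.iSup_nonneg fun n => backward_nonneg hω n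

lemma integrable_loynes (hν : IsStable ν) : Integrable loynes (seqLaw ν) := by
  refine ⟨measurable_loynes.aestronglyMeasurable, ?_⟩
  rw [hasFiniteIntegral_iff_ofReal (ae_loynes_nonneg hν)]
  refine lt_of_le_of_lt (lintegral_mono_ae ?_) (lintegral_iSup_backward_lt_top hν)
  filter_upwards [ae_tendsto_backward hν] with ω hω
  exact le_of_tendsto' ((ENNReal.continuous_ofReal.tendsto _).comp hω)
    fun n => le_iSup (fun n => ENNReal.ofReal (backward n ω)) n

lemma ae_loynes_eq_step (hν : IsStable ν) :
    ∀ᵐ ω ∂(seqLaw ν), loynes ω = step (loynes (shift ω)) (ω 0) := by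
  filter_upwards [ae_tendsto_backward hν,
    (measurePreserving_shift ν).quasiMeasurePreserving.ae (ae_tendsto_backward hν)] with ω h1 h2
  exact tendsto_nhds_unique (h1.comp (tendsto_add_atTop_nat 1))
    (((continuous_step (ω 0)).tendsto _).comp h2)

/-- The stationary law of the sojourn time. -/
noncomputable def statLaw (ν : Measure (ℝ × ℝ)) [IsProbabilityMeasure ν] : Measure ℝ :=
  (seqLaw ν).map loynes

lemma measurePreserving_loynes : MeasurePreserving loynes (seqLaw ν) (statLaw ν) :=
  ⟨measurable_loynes, rfl⟩

instance : IsProbabilityMeasure (statLaw ν) :=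
  Measure.isProbabilityMeasure_map measurable_loynes.aemeasurable

lemma integrable_statLaw (hν : IsStable ν) : Integrable (fun u : ℝ => u) (statLaw ν) :=
  (integrable_map_measure aestronglyMeasurable_id measurable_loynes.aemeasurable).2
    (integrable_loynes hν)

lemma ae_statLaw_nonneg (hν : IsStable ν) : ∀ᵐ u ∂(statLaw ν), 0 ≤ u :=
  (ae_map_iff measurable_loynes.aemeasurable measurableSet_Ici).2 (ae_loynes_nonneg hν)

/-- Loynes' variable is a `step` applied to its own shift and to ω 0, and these two are independent.
-/
lemma measurePreserving_step (hν : IsStable ν) :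
    MeasurePreserving (fun p : ℝ × (ℝ × ℝ) => step p.1 p.2) ((statLaw ν).prod ν) (statLaw ν) where
  measurable := measurable_step
  map_eq := by
    have h := (measurePreserving_loynes.prod (MeasurePreserving.id ν)).comp
      (Measure.measurePreserving_swap.comp (measurePreserving_zero_shift ν))
    rw [← h.map_eq, Measure.map_map measurable_step h.measurable, statLaw]
    exact (Measure.map_congr (ae_loynes_eq_step hν)).symm

/-- The recursion driven by an i.i.d. sequence, as a map of (state, future input). -/
noncomputable def skew (p : ℝ × (ℕ → ℝ × ℝ)) : ℝ × (ℕ → ℝ × ℝ) := (step p.1 (p.2 0), shift p.2)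

lemma measurePreserving_skew (hν : IsStable ν) :
    MeasurePreserving skew ((statLaw ν).prod (seqLaw ν)) ((statLaw ν).prod (seqLaw ν)) := by
  have h1 := (MeasurePreserving.id (statLaw ν)).prod (measurePreserving_zero_shift ν)
  have h2 := (measurePreserving_prodAssoc (statLaw ν) ν (seqLaw ν)).symm
  have h3 := (measurePreserving_step hν).prod (MeasurePreserving.id (seqLaw ν))
  exact h3.comp (h2.comp h1)

end Law

/-- The sojourn times of the queue with input `ω` and initial state `w`. -/
noncomputable def sojourn (w : ℝ) (ω : ℕ → ℝ × ℝ) : ℕ → ℝ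
  | 0 => w
  | n + 1 => step (sojourn w ω n) (ω n)

lemma skew_iterate (w : ℝ) (ω : ℕ → ℝ × ℝ) (n : ℕ) :
    skew^[n] (w, ω) = (sojourn w ω n, shift^[n] ω) := by
  induction n with
  | zero => rfl
  | succ n ih =>
    rw [Function.iterate_succ_apply', Function.iterate_succ_apply', ih, skew, sojourn]
    simp [shift_iterate_apply]

lemma sojourn_mono {v w : ℝ} (h : v ≤ w) (ω : ℕ → ℝ × ℝ) (n : ℕ) :
    sojourn v ω n ≤ sojourn w ω n := by
  induction n with
  | zero => exact h
  | succ n ih => exact step_mono ih _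

lemma sojourn_eq_of_le {v w : ℝ} (ω : ℕ → ℝ × ℝ) {m n : ℕ} (hmn : m ≤ n)
    (h : sojourn v ω m = sojourn w ω m) : sojourn v ω n = sojourn w ω n := by
  induction n, hmn using Nat.le_induction with
  | base => exact h
  | succ n _ ih => rw [sojourn, sojourn, ih]

/-- Two copies of the queue with the same input coalesce once the larger one has emptied. -/
lemma eventually_sojourn_eq {ω : ℕ → ℝ × ℝ} (hpos : ∀ k, 0 < (ω k).1 ∧ 0 < (ω k).2)
    (hdrift : Tendsto (fun n => ∑ k ∈ Finset.range n, ((ω k).2 - (ω k).1)) atTop atBot)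
    (v w : ℝ) : ∀ᶠ n in atTop, sojourn v ω n = sojourn w ω n := by
  wlog hvw : v ≤ w generalizing v w
  · exact (this w v (le_of_not_ge hvw)).mono fun n hn => hn.symm
  -- If the queue never emptied, truncation would never act and the sojourn time would follow the
  -- drift to -∞ while staying positive. At an emptying time both copies reset to the same service
  -- time.
  obtain ⟨m, hm⟩ : ∃ m, sojourn w ω m ≤ (ω m).1 := by
    by_contra! h
    have hsum : ∀ n, sojourn w ω n = w + ∑ k ∈ Finset.range n, ((ω k).2 - (ω k).1) := by
      intro n
      induction n with
      | zero => simp [sojourn]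
      | succ n ih =>
        rw [sojourn, step, max_eq_left (sub_nonneg.2 (h n).le), ih, Finset.sum_range_succ]
        ring
    obtain ⟨n, hn⟩ := (hdrift.eventually_le_atBot (-w)).exists
    linarith [hsum n, h n, (hpos n).1]
  filter_upwards [eventually_ge_atTop (m + 1)] with n hn
  refine sojourn_eq_of_le ω hn ?_
  have hm' : sojourn v ω m ≤ (ω m).1 := (sojourn_mono hvw ω m).trans hm
  rw [sojourn, sojourn, step, step, max_eq_right (sub_nonpos.2 hm),
    max_eq_right (sub_nonpos.2 hm')]

section Ergodicity

variable {ν : Measure (ℝ × ℝ)} [IsProbabilityMeasure ν]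

lemma ae_tendsto_drift (hν : IsStable ν) : ∀ᵐ ω ∂(seqLaw ν),
    Tendsto (fun n => ∑ k ∈ Finset.range n, ((ω k).2 - (ω k).1)) atTop atBot := by
  have hint : Integrable (fun e : ℝ × ℝ => e.2 - e.1) ν :=
    (hν.memLp_snd.integrable one_le_two).sub (hν.memLp_fst.integrable one_le_two)
  have h0 := measurePreserving_apply ν 0
  filter_upwards [tendsto_birkhoffSum_div (ergodic_shift ν)
    (f := fun ω : ℕ → ℝ × ℝ => (ω 0).2 - (ω 0).1) (by fun_prop)
    (h0.integrable_comp_of_integrable hint)] with ω hω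
  rw [integral_comp_of_measurePreserving h0 (f := fun e : ℝ × ℝ => e.2 - e.1) (by fun_prop),
    integral_sub (hν.memLp_snd.integrable one_le_two) (hν.memLp_fst.integrable one_le_two)] at hω
  refine (hω.neg_mul_atTop (sub_neg.2 hν.integral_lt) tendsto_natCast_atTop_atTop).congr' ?_
  filter_upwards [eventually_ne_atTop 0] with n hn
  rw [div_mul_cancel₀ _ (by exact_mod_cast hn), birkhoffSum]
  simp [shift_iterate_apply]

lemma ae_eventually_sojourn_eq (hν : IsStable ν) : ∀ᵐ ω ∂(seqLaw ν),
    ∀ v w, ∀ᶠ n in atTop, sojourn v ω n = sojourn w ω n := by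
  filter_upwards [hν.ae_pos, ae_tendsto_drift hν] with ω h1 h2 v w
  exact eventually_sojourn_eq h1 h2 v w

/-- The stationary queue is ergodic. -/
lemma ergodic_skew (hν : IsStable ν) : Ergodic skew ((statLaw ν).prod (seqLaw ν)) := by
  refine ⟨measurePreserving_skew hν, ⟨fun s hs hinv => ?_⟩⟩
  have hiter : ∀ n p, skew^[n] p ∈ s ↔ p ∈ s := by
    intro n p
    induction n with
    | zero => rfl
    | succ n ih =>
      rw [Function.iterate_succ_apply', ← ih]
      exact Set.ext_iff.1 hinv _
  -- Coalescence makes an invariant set independent of the state, so it comes from an almost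
  -- invariant set of inputs, and ergodicity of the shift decides it.
  have hindep : ∀ᵐ ω ∂(seqLaw ν), ∀ v w, (v, ω) ∈ s ↔ (w, ω) ∈ s := by
    filter_upwards [ae_eventually_sojourn_eq hν] with ω hω v w
    obtain ⟨n, hn⟩ := (hω v w).exists
    rw [← hiter n (v, ω), ← hiter n (w, ω), skew_iterate, skew_iterate, hn]
  have hs0 : MeasurableSet {ω : ℕ → ℝ × ℝ | (0, ω) ∈ s} := measurable_prodMk_left hs
  have hinv0 : shift ⁻¹' {ω : ℕ → ℝ × ℝ | (0, ω) ∈ s} =ᵐ[seqLaw ν] {ω | (0, ω) ∈ s} := by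
    filter_upwards [(measurePreserving_shift ν).quasiMeasurePreserving.ae hindep] with ω hω
    refine propext ?_
    change (0, shift ω) ∈ s ↔ (0, ω) ∈ s
    rw [← hiter 1 (0, ω), hω 0 (step 0 (ω 0))]
    rfl
  have hsnd : ∀ᵐ p ∂((statLaw ν).prod (seqLaw ν)), p ∈ s ↔ (0, p.2) ∈ s :=
    (Measure.quasiMeasurePreserving_snd.ae hindep).mono fun p hp => hp p.1 0
  rw [eventuallyConst_set]
  refine ((ergodic_shift ν).quasiErgodic.ae_mem_or_ae_notMem₀ hs0.nullMeasurableSet hinv0).imp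
    (fun h => ?_) fun h => ?_
  · filter_upwards [hsnd, Measure.quasiMeasurePreserving_snd.ae h] with p h1 h2 using h1.2 h2
  · filter_upwards [hsnd, Measure.quasiMeasurePreserving_snd.ae h] with p h1 h2
      using fun h3 => h2 (h1.1 h3)

/-- Ergodic averages along the queue started from an arbitrary state. -/
lemma ae_tendsto_average (hν : IsStable ν) {f : ℝ × (ℝ × ℝ) → ℝ} (hfm : Measurable f)
    (hf : Integrable f ((statLaw ν).prod ν)) :
    ∀ᵐ ω ∂(seqLaw ν), ∀ w,
      Tendsto (fun n : ℕ => (∑ k ∈ Finset.range n, f (sojourn w ω k, ω k)) / n) atTop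
        (𝓝 (∫ p, f p ∂((statLaw ν).prod ν))) := by
  have h0 : MeasurePreserving (fun p : ℝ × (ℕ → ℝ × ℝ) => (p.1, p.2 0))
      ((statLaw ν).prod (seqLaw ν)) ((statLaw ν).prod ν) :=
    (MeasurePreserving.id (statLaw ν)).prod (measurePreserving_apply ν 0)
  have hB := tendsto_birkhoffSum_div (ergodic_skew hν) (f := fun p : ℝ × (ℕ → ℝ × ℝ) => f (p.1, p.2 0))
    (hfm.comp h0.measurable) (h0.integrable_comp_of_integrable hf)
  -- Fubini supplies one good state u; coalescence transfers its limit to every w, since only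
  -- finitely many terms differ. The null set does not depend on w, so w may later be random.
  obtain ⟨u, hu⟩ := (Measure.ae_ae_of_ae_prod hB).exists
  filter_upwards [hu, ae_eventually_sojourn_eq hν] with ω hω hco w
  rw [integral_comp_of_measurePreserving h0 hfm] at hω
  have hsum : ∀ n, birkhoffSum skew (fun p => f (p.1, p.2 0)) n (u, ω) =
      ∑ k ∈ Finset.range n, f (sojourn u ω k, ω k) := fun n => by
    simp [birkhoffSum, skew_iterate, shift_iterate_apply]
  simp_rw [hsum] at hω
  obtain ⟨N, hN⟩ := eventually_atTop.1 (hco w u)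
  have hdiff : Tendsto (fun n : ℕ => (∑ k ∈ Finset.range N,
      (f (sojourn w ω k, ω k) - f (sojourn u ω k, ω k))) / (n : ℝ)) atTop (𝓝 0) :=
    tendsto_const_div_atTop_nhds_zero_nat _
  have := hω.add hdiff
  rw [add_zero] at this
  refine this.congr' ?_
  filter_upwards [eventually_ge_atTop N] with n hn
  rw [← add_div]
  congr 1
  rw [← Finset.sum_range_add_sum_Ico _ hn, ← Finset.sum_range_add_sum_Ico _ hn,
    Finset.sum_sub_distrib, Finset.sum_congr (rfl : Finset.Ico N n = _)
      (fun k hk => by rw [hN k (Finset.mem_Ico.1 hk).1] :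
        ∀ k ∈ Finset.Ico N n, f (sojourn w ω k, ω k) = f (sojourn u ω k, ω k))]
  ring

end Ergodicity

end Lindley

/-! ### The area under the age and its stationary mean. -/

namespace Lindley

open Shift ErgodicAverage

/-- The area below the age between two successive receptions, the first one ending a sojourn time
`u`. -/
noncomputable def area (u : ℝ) (e : ℝ × ℝ) : ℝ := ((step u e + e.1) ^ 2 - u ^ 2) / 2

lemma area_eq (u : ℝ) (e : ℝ × ℝ) :
    area u e = step u e * e.1 + e.1 ^ 2 / 2 + (step u e ^ 2 / 2 - u ^ 2 / 2) := by
  unfold area; ring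

lemma area_nonneg {u : ℝ} {e : ℝ × ℝ} (hu : 0 ≤ u) (h2 : 0 ≤ e.2) : 0 ≤ area u e := by
  unfold area
  have := le_step u e
  have : u ^ 2 ≤ (step u e + e.1) ^ 2 := pow_le_pow_left₀ hu (by linarith) 2
  linarith

/-- The squares of u cancel: the bound is linear in u, so a first moment of the stationary law is
enough for integrability. -/
lemma area_le {u : ℝ} {e : ℝ × ℝ} (hu : 0 ≤ u) (h1 : 0 ≤ e.1) (h2 : 0 ≤ e.2) :
    area u e ≤ u * (e.1 + e.2) + (e.1 + e.2) ^ 2 / 2 := by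
  unfold area
  have h3 := step_le (e := e) hu h1
  have h4 := step_nonneg h2 u
  have : (step u e + e.1) ^ 2 ≤ (u + e.2 + e.1) ^ 2 :=
    pow_le_pow_left₀ (by linarith) (by linarith) 2
  nlinarith

lemma IsStable.integrable_mul {ν : Measure (ℝ × ℝ)} (hν : IsStable ν) :
    Integrable (fun e : ℝ × ℝ => e.1 * e.2) ν :=
  hν.memLp_fst.integrable_mul hν.memLp_snd

section Stationary

variable {ν : Measure (ℝ × ℝ)} [IsProbabilityMeasure ν]

lemma IsStable.ae_prod (hν : IsStable ν) :
    ∀ᵐ p ∂((statLaw ν).prod ν), 0 ≤ p.1 ∧ 0 ≤ p.2.1 ∧ 0 ≤ p.2.2 := by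
  filter_upwards [Measure.quasiMeasurePreserving_fst.ae (ae_statLaw_nonneg hν),
    Measure.quasiMeasurePreserving_snd.ae hν.fst_pos,
    Measure.quasiMeasurePreserving_snd.ae hν.snd_pos] with p h0 h1 h2 using ⟨h0, h1.le, h2.le⟩

lemma IsStable.integrable_fst (hν : IsStable ν) : Integrable (fun e : ℝ × ℝ => e.1) ν :=
  hν.memLp_fst.integrable one_le_two

lemma IsStable.integrable_snd (hν : IsStable ν) : Integrable (fun e : ℝ × ℝ => e.2) ν :=
  hν.memLp_snd.integrable one_le_two

lemma integrable_step (hν : IsStable ν) :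
    Integrable (fun p : ℝ × (ℝ × ℝ) => step p.1 p.2) ((statLaw ν).prod ν) :=
  (measurePreserving_step hν).integrable_comp_of_integrable (integrable_statLaw hν)

lemma integrable_step_mul (hν : IsStable ν) :
    Integrable (fun p : ℝ × (ℝ × ℝ) => step p.1 p.2 * p.2.1) ((statLaw ν).prod ν) := by
  refine (((integrable_statLaw hν).mul_prod hν.integrable_fst).add
    (hν.integrable_mul.comp_snd (statLaw ν))).mono'
    ((measurable_step.mul (by fun_prop)).aestronglyMeasurable) ?_
  filter_upwards [hν.ae_prod] with p ⟨h0, h1, h2⟩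
  rw [Real.norm_of_nonneg (mul_nonneg (step_nonneg h2 _) h1)]
  refine (mul_le_mul_of_nonneg_right (step_le h0 h1) h1).trans_eq ?_
  simp only [Pi.add_apply]
  ring

lemma measurable_area : Measurable fun p : ℝ × (ℝ × ℝ) => area p.1 p.2 := by
  unfold area; have := measurable_step; fun_prop

lemma integrable_area (hν : IsStable ν) :
    Integrable (fun p : ℝ × (ℝ × ℝ) => area p.1 p.2) ((statLaw ν).prod ν) := by
  refine (((integrable_statLaw hν).mul_prod (hν.integrable_fst.add hν.integrable_snd)).add
    (((hν.memLp_fst.add hν.memLp_snd).integrable_sq.comp_snd (statLaw ν)).div_const 2)).mono'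
    measurable_area.aestronglyMeasurable ?_
  filter_upwards [hν.ae_prod] with p ⟨h0, h1, h2⟩
  rw [Real.norm_of_nonneg (area_nonneg h0 h2)]
  exact area_le h0 h1 h2

lemma integral_area (hν : IsStable ν) :
    ∫ p, area p.1 p.2 ∂((statLaw ν).prod ν) =
      ∫ p, step p.1 p.2 * p.2.1 ∂((statLaw ν).prod ν) + (∫ e, e.1 ^ 2 ∂ν) / 2 := by
  have hsq : Integrable (fun p : ℝ × (ℝ × ℝ) => p.2.1 ^ 2 / 2) ((statLaw ν).prod ν) :=
    (hν.memLp_fst.integrable_sq.comp_snd (statLaw ν)).div_const 2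
  -- The two squares need not be integrable separately; their difference is, because the other terms
  -- of `area_eq` are.
  have hcob : Integrable (fun p : ℝ × (ℝ × ℝ) => step p.1 p.2 ^ 2 / 2 - p.1 ^ 2 / 2)
      ((statLaw ν).prod ν) := by
    refine (((integrable_area hν).sub (integrable_step_mul hν)).sub hsq).congr
      (ae_of_all _ fun p => ?_)
    simp only [Pi.sub_apply, area_eq]
    ring
  have h0 : MeasurePreserving (fun p : ℝ × (ℕ → ℝ × ℝ) => (p.1, p.2 0))
      ((statLaw ν).prod (seqLaw ν)) ((statLaw ν).prod ν) :=
    (MeasurePreserving.id (statLaw ν)).prod (measurePreserving_apply ν 0)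
  have hzero : ∫ p, (step p.1 p.2 ^ 2 / 2 - p.1 ^ 2 / 2) ∂((statLaw ν).prod ν) = 0 := by
    rw [← integral_comp_of_measurePreserving h0
      (f := fun p : ℝ × (ℝ × ℝ) => step p.1 p.2 ^ 2 / 2 - p.1 ^ 2 / 2)
      (by have := measurable_step; fun_prop)]
    exact integral_comp_sub_eq_zero (ergodic_skew hν)
      (g := fun p : ℝ × (ℕ → ℝ × ℝ) => p.1 ^ 2 / 2) (by fun_prop)
      (h0.integrable_comp_of_integrable hcob)
  simp_rw [area_eq]
  rw [integral_add (f := fun p : ℝ × (ℝ × ℝ) => step p.1 p.2 * p.2.1 + p.2.1 ^ 2 / 2)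
    ((integrable_step_mul hν).add hsq) hcob, hzero, add_zero,
    integral_add (integrable_step_mul hν) hsq, integral_div,
    integral_fun_snd (fun e : ℝ × ℝ => e.1 ^ 2)]
  simp

lemma integral_fst_mul (ν : Measure (ℝ × ℝ)) [IsProbabilityMeasure ν] :
    ∫ p, p.1 * p.2.1 ∂((statLaw ν).prod ν) = (∫ u, u ∂(statLaw ν)) * ∫ e, e.1 ∂ν :=
  integral_prod_mul (fun u : ℝ => u) (fun e : ℝ × ℝ => e.1)

lemma integral_step_mul_le (hν : IsStable ν) :
    ∫ p, step p.1 p.2 * p.2.1 ∂((statLaw ν).prod ν) ≤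
      (∫ u, u ∂(statLaw ν)) * (∫ e, e.1 ∂ν) + (∫ e, e.1 ∂ν) * ∫ e, e.2 ∂ν := by
  rw [← integral_fst_mul, ← hν.integral_mul]
  have h2 : Integrable (fun p : ℝ × (ℝ × ℝ) => p.2.1 * p.2.2) ((statLaw ν).prod ν) :=
    hν.integrable_mul.comp_snd (statLaw ν)
  have h1 := (integrable_statLaw hν).mul_prod hν.integrable_fst
  have h3 : ∫ p, p.2.1 * p.2.2 ∂((statLaw ν).prod ν) = ∫ e, e.1 * e.2 ∂ν := by
    rw [integral_fun_snd (fun e : ℝ × ℝ => e.1 * e.2)]; simp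
  rw [← h3, ← integral_add h1 h2]
  refine integral_mono_ae (integrable_step_mul hν) (h1.add h2) ?_
  filter_upwards [hν.ae_prod] with p ⟨h0, h1, h2⟩
  exact (mul_le_mul_of_nonneg_right (step_le h0 h1) h1).trans_eq (by ring)

lemma le_integral_step_mul (hν : IsStable ν) :
    (∫ u, u ∂(statLaw ν)) * (∫ e, e.1 ∂ν) - ∫ e, e.1 ^ 2 ∂ν ≤
      ∫ p, step p.1 p.2 * p.2.1 ∂((statLaw ν).prod ν) := by
  rw [← integral_fst_mul]
  have h2 : Integrable (fun p : ℝ × (ℝ × ℝ) => p.2.1 ^ 2) ((statLaw ν).prod ν) :=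
    hν.memLp_fst.integrable_sq.comp_snd (statLaw ν)
  have h1 := (integrable_statLaw hν).mul_prod hν.integrable_fst
  have h3 : ∫ p, p.2.1 ^ 2 ∂((statLaw ν).prod ν) = ∫ e, e.1 ^ 2 ∂ν := by
    rw [integral_fun_snd (fun e : ℝ × ℝ => e.1 ^ 2)]; simp
  rw [← h3, ← integral_sub h1 h2]
  refine integral_mono_ae (h1.sub h2) (integrable_step_mul hν) ?_
  filter_upwards [hν.ae_prod] with p ⟨h0, h1, h2⟩
  have := mul_le_mul_of_nonneg_right (le_step p.1 p.2) h1
  nlinarith [mul_nonneg h1 h2]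

end Stationary

end Lindley

/-! ### The age along a sample path. -/

namespace GG1

open Lindley

/-- If a cumulative reward `G` is monotone and its values at the epochs `D n` grow like `n * β`
while `D n` grows like `n * m`, then `G T / T` tends to `β / m`. -/
lemma tendsto_div_of_epochs {G : ℝ → ℝ} {D : ℕ → ℝ} {β m : ℝ} (hm : 0 < m)
    (hG0 : ∀ t, 0 ≤ t → 0 ≤ G t) (hG : ∀ s t, 0 ≤ s → s ≤ t → G s ≤ G t)
    (hD0 : 0 < D 0) (hD : Monotone D)
    (hDlim : Tendsto (fun n : ℕ => D n / n) atTop (𝓝 m))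
    (hGlim : Tendsto (fun n : ℕ => G (D n) / n) atTop (𝓝 β)) :
    Tendsto (fun T => G T / T) atTop (𝓝 (β / m)) := by
  have hDpos : ∀ n, 0 < D n := fun n => hD0.trans_le (hD (Nat.zero_le n))
  have hDtop : Tendsto D atTop atTop := by
    refine (hDlim.pos_mul_atTop hm tendsto_natCast_atTop_atTop).congr' ?_
    filter_upwards [eventually_ne_atTop 0] with n hn
    exact div_mul_cancel₀ _ (by exact_mod_cast hn)
  have hratio : Tendsto (fun n : ℕ => ((n + 1 : ℕ) : ℝ) / (n : ℝ)) atTop (𝓝 1) := by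
    have : Tendsto (fun n : ℕ => 1 + 1 / (n : ℝ)) atTop (𝓝 (1 + 0)) :=
      tendsto_const_nhds.add tendsto_one_div_atTop_nhds_zero_nat
    rw [add_zero] at this
    refine this.congr' ?_
    filter_upwards [eventually_ne_atTop 0] with n hn
    have : (n : ℝ) ≠ 0 := by exact_mod_cast hn
    push_cast
    field_simp
  have hsucc := tendsto_add_atTop_nat 1
  have hup : Tendsto (fun n => G (D (n + 1)) / D n) atTop (𝓝 (β / m)) := by
    have := ((hGlim.comp hsucc).mul hratio).div hDlim hm.ne'
    rw [mul_one] at this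
    refine this.congr' ?_
    filter_upwards [eventually_ne_atTop 0] with n hn
    have h1 : (n : ℝ) ≠ 0 := by exact_mod_cast hn
    have h2 : ((n + 1 : ℕ) : ℝ) ≠ 0 := by positivity
    have h3 := (hDpos n).ne'
    simp only [Pi.div_apply, Function.comp_apply]
    field_simp
  have hlow : Tendsto (fun n => G (D n) / D (n + 1)) atTop (𝓝 (β / m)) := by
    have := hGlim.div ((hDlim.comp hsucc).mul hratio) (by simpa using hm.ne')
    rw [mul_one] at this
    refine this.congr' ?_
    filter_upwards [eventually_ne_atTop 0] with n hn
    have h1 : (n : ℝ) ≠ 0 := by exact_mod_cast hn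
    have h2 : ((n + 1 : ℕ) : ℝ) ≠ 0 := by positivity
    have h3 := (hDpos (n + 1)).ne'
    simp only [Pi.div_apply, Function.comp_apply]
    field_simp
  -- The index before the first epoch beyond T brackets T between D n and D (n + 1). Once T ≥ D 0
  -- that first index is positive, so the natural subtraction is genuine.
  have hex : ∀ T, ∃ n, T < D n := fun T => (hDtop.eventually_gt_atTop T).exists
  classical
  have hfind : Tendsto (fun T => Nat.find (hex T) - 1) atTop atTop := by
    refine tendsto_atTop.2 fun n => ?_
    filter_upwards [eventually_ge_atTop (D n)] with T hT
    have : n < Nat.find (hex T) := (Nat.lt_find_iff _ _).2 fun k hk =>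
      not_lt.2 ((hD hk).trans hT)
    omega
  have hbounds : ∀ᶠ T in atTop, 0 < T ∧ D (Nat.find (hex T) - 1) ≤ T ∧
      T ≤ D (Nat.find (hex T) - 1 + 1) := by
    filter_upwards [eventually_ge_atTop (D 0)] with T hT
    have hpos : 0 < Nat.find (hex T) := (Nat.find_pos _).2 (not_lt.2 hT)
    refine ⟨hD0.trans_le hT, not_lt.1 (Nat.find_min (hex T) (by omega)), ?_⟩
    rw [Nat.sub_add_cancel hpos]
    exact (Nat.find_spec (hex T)).le
  refine tendsto_of_tendsto_of_tendsto_of_le_of_le' (hlow.comp hfind) (hup.comp hfind) ?_ ?_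
  · filter_upwards [hbounds] with T ⟨h0, h1, h2⟩
    exact div_le_div₀ (hG0 T h0.le) (hG _ _ (hDpos _).le h1) h0 h2
  · filter_upwards [hbounds] with T ⟨h0, h1, h2⟩
    exact div_le_div₀ (hG0 _ (hDpos _).le) (hG _ _ h0.le h2) (hDpos _) h1

section Path

variable {w₀ a₀ : ℝ} {i x : ℕ → ℝ}

/-- The backlog acts as a fictitious customer arriving at time 0 with sojourn time w₀; hence packet
k has sojourn index k + 1. -/
lemma departure_eq (w₀ : ℝ) (i x : ℕ → ℝ) (k : ℕ) :
    departure w₀ i x k = arrival i k + sojourn w₀ (fun n => (i n, x n)) (k + 1) := by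
  have hmax : ∀ a b : ℝ, max a b = b + max (a - b) 0 := fun a b => by
    rw [← max_add_add_left]; simp
  induction k with
  | zero => simp only [departure, sojourn, step]; rw [hmax]; simp [arrival, add_assoc]
  | succ k ih =>
    rw [departure, sojourn, step, ih, hmax, add_assoc]
    congr 3
    simp only [arrival, Finset.sum_range_succ _ (k + 1)]
    ring

lemma strictMono_arrival (hi : ∀ k, 0 < i k) : StrictMono (arrival i) :=
  strictMono_nat_of_lt_succ fun n => by
    simp only [arrival, Finset.sum_range_succ _ (n + 1)]; linarith [hi (n + 1)]

lemma strictMono_departure (hx : ∀ k, 0 < x k) : StrictMono (departure w₀ i x) :=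
  strictMono_nat_of_lt_succ fun n => by
    rw [departure]; linarith [hx (n + 1), le_max_left (departure w₀ i x n) (arrival i (n + 1))]

lemma arrival_pos (hi : ∀ k, 0 < i k) (k : ℕ) : 0 < arrival i k :=
  Finset.sum_pos (fun j _ => hi j) (by simp)

lemma arrival_le_departure (hx : ∀ k, 0 < x k) (k : ℕ) : arrival i k ≤ departure w₀ i x k := by
  cases k with
  | zero => rw [departure]; linarith [hx 0, le_max_right w₀ (arrival i 0)]
  | succ k =>
    rw [departure]; linarith [hx (k + 1), le_max_right (departure w₀ i x k) (arrival i (k + 1))]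

lemma departure_pos (hi : ∀ k, 0 < i k) (hx : ∀ k, 0 < x k) (k : ℕ) : 0 < departure w₀ i x k :=
  (arrival_pos hi k).trans_le (arrival_le_departure hx k)

lemma age_of_lt (hx : ∀ k, 0 < x k) {t : ℝ} (ht : t < departure w₀ i x 0) :
    age w₀ a₀ i x t = t + a₀ := by
  have : {s : ℝ | ∃ k : ℕ, departure w₀ i x k ≤ t ∧ s = arrival i k} = ∅ := by
    refine Set.eq_empty_of_forall_notMem ?_
    rintro s ⟨k, hk, -⟩
    exact (ht.trans_le ((strictMono_departure hx).monotone (Nat.zero_le k))).not_ge hk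
  rw [age, lastGenerated, this]
  simp

lemma age_of_mem_Ico (ha : 0 ≤ a₀) (hi : ∀ k, 0 < i k) (hx : ∀ k, 0 < x k) {k : ℕ} {t : ℝ}
    (ht : t ∈ Set.Ico (departure w₀ i x k) (departure w₀ i x (k + 1))) :
    age w₀ a₀ i x t = t - arrival i k := by
  have : IsGreatest (insert (-a₀) {s : ℝ | ∃ k : ℕ, departure w₀ i x k ≤ t ∧ s = arrival i k})
      (arrival i k) := by
    refine ⟨Or.inr ⟨k, ht.1, rfl⟩, ?_⟩
    rintro s (rfl | ⟨j, hj, rfl⟩)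
    · linarith [arrival_pos hi k]
    · refine (strictMono_arrival hi).monotone ?_
      have := (strictMono_departure hx).lt_iff_lt.1 (hj.trans_lt ht.2)
      omega
  rw [age, lastGenerated, this.csSup_eq]

/-- Just before the reception the freshest update is still packet k, generated one inter-arrival
time before packet k + 1. Peak 0 is excluded because it depends on a₀. -/
lemma peak_succ (ha : 0 ≤ a₀) (hi : ∀ k, 0 < i k) (hx : ∀ k, 0 < x k) (k : ℕ) :
    peak w₀ a₀ i x (k + 1) =
      sojourn w₀ (fun n => (i n, x n)) (k + 2) + i (k + 1) := by
  have hlt := strictMono_departure (w₀ := w₀) (i := i) hx (Nat.lt_succ_self k)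
  have hlim : Tendsto (age w₀ a₀ i x) (𝓝[<] departure w₀ i x (k + 1))
      (𝓝 (departure w₀ i x (k + 1) - arrival i k)) := by
    refine Tendsto.congr' (f₁ := fun t => t - arrival i k) ?_ ?_
    · filter_upwards [Ioo_mem_nhdsLT hlt] with t ht
      exact (age_of_mem_Ico ha hi hx ⟨ht.1.le, ht.2⟩).symm
    · exact ((continuous_id.sub continuous_const).tendsto _).mono_left nhdsWithin_le_nhds
  rw [peak, leftLim_eq_of_tendsto hlim, departure_eq]
  simp only [arrival, Finset.sum_range_succ _ (k + 1)]
  ring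

lemma age_nonneg (ha : 0 ≤ a₀) (hx : ∀ k, 0 < x k) {t : ℝ} (ht : 0 ≤ t) :
    0 ≤ age w₀ a₀ i x t := by
  rw [age, lastGenerated, sub_nonneg]
  refine csSup_le (Set.insert_nonempty _ _) ?_
  rintro s (rfl | ⟨k, hk, rfl⟩)
  · linarith
  · exact (arrival_le_departure hx k).trans hk

lemma intervalIntegrable_age_first (hi : ∀ k, 0 < i k) (hx : ∀ k, 0 < x k) :
    IntervalIntegrable (age w₀ a₀ i x) volume 0 (departure w₀ i x 0) := by
  have h : IntervalIntegrable (fun t : ℝ => t + a₀) volume 0 (departure w₀ i x 0) :=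
    (by fun_prop : Continuous fun t : ℝ => t + a₀).intervalIntegrable _ _
  refine h.congr_uIoo fun t ht => ?_
  rw [Set.uIoo_of_le (departure_pos hi hx 0).le] at ht
  exact (age_of_lt hx ht.2).symm

lemma intervalIntegrable_age_succ (ha : 0 ≤ a₀) (hi : ∀ k, 0 < i k) (hx : ∀ k, 0 < x k) (k : ℕ) :
    IntervalIntegrable (age w₀ a₀ i x) volume (departure w₀ i x k) (departure w₀ i x (k + 1)) := by
  have h : IntervalIntegrable (fun t : ℝ => t - arrival i k) volume
      (departure w₀ i x k) (departure w₀ i x (k + 1)) :=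
    (by fun_prop : Continuous fun t : ℝ => t - arrival i k).intervalIntegrable _ _
  refine h.congr_uIoo fun t ht => ?_
  rw [Set.uIoo_of_le (strictMono_departure hx (Nat.lt_succ_self k)).le] at ht
  exact (age_of_mem_Ico ha hi hx ⟨ht.1.le, ht.2⟩).symm

lemma intervalIntegrable_age_departure (ha : 0 ≤ a₀) (hi : ∀ k, 0 < i k) (hx : ∀ k, 0 < x k)
    (k : ℕ) : IntervalIntegrable (age w₀ a₀ i x) volume 0 (departure w₀ i x k) := by
  induction k with
  | zero => exact intervalIntegrable_age_first hi hx
  | succ k ih => exact ih.trans (intervalIntegrable_age_succ ha hi hx k)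

lemma integral_age_succ (ha : 0 ≤ a₀) (hi : ∀ k, 0 < i k) (hx : ∀ k, 0 < x k) (k : ℕ) :
    ∫ t in (departure w₀ i x k)..(departure w₀ i x (k + 1)), age w₀ a₀ i x t =
      area (sojourn w₀ (fun n => (i n, x n)) (k + 1)) (i (k + 1), x (k + 1)) := by
  rw [intervalIntegral.integral_congr_Ioo_of_le (g := fun t => t - arrival i k)
    (strictMono_departure hx (Nat.lt_succ_self k)).le
    fun t ht => age_of_mem_Ico ha hi hx ⟨ht.1.le, ht.2⟩,
    intervalIntegral.integral_comp_sub_right (fun t => t), integral_id, area,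
    departure_eq, departure_eq]
  simp only [arrival, Finset.sum_range_succ _ (k + 1), sojourn]
  ring

lemma integral_age_departure (ha : 0 ≤ a₀) (hi : ∀ k, 0 < i k) (hx : ∀ k, 0 < x k) (n : ℕ) :
    ∫ t in (0 : ℝ)..(departure w₀ i x n), age w₀ a₀ i x t =
      (∫ t in (0 : ℝ)..(departure w₀ i x 0), age w₀ a₀ i x t) +
        ∑ k ∈ Finset.range n,
          area (sojourn w₀ (fun n => (i n, x n)) (k + 1)) (i (k + 1), x (k + 1)) := by
  induction n with
  | zero => simp
  | succ n ih =>
    rw [Finset.sum_range_succ, ← add_assoc, ← ih, ← integral_age_succ ha hi hx n,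
      intervalIntegral.integral_add_adjacent_intervals
        (intervalIntegrable_age_departure ha hi hx n) (intervalIntegrable_age_succ ha hi hx n)]

end Path

/-- Changing the first term does not affect the limit of averages. -/
lemma tendsto_average_shift {u : ℕ → ℝ} {L : ℝ}
    (h : Tendsto (fun n : ℕ => (∑ k ∈ Finset.range n, u k) / n) atTop (𝓝 L)) (c : ℝ) :
    Tendsto (fun n : ℕ => (c + ∑ k ∈ Finset.range n, u (k + 1)) / n) atTop (𝓝 L) := by
  have h1 := h.comp (tendsto_add_atTop_nat 1)
  have h2 : Tendsto (fun n : ℕ => 1 + 1 / (n : ℝ)) atTop (𝓝 (1 + 0)) :=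
    tendsto_const_nhds.add tendsto_one_div_atTop_nhds_zero_nat
  have h3 : Tendsto (fun n : ℕ => (c - u 0) / (n : ℝ)) atTop (𝓝 0) :=
    tendsto_const_div_atTop_nhds_zero_nat _
  have h4 := (h1.mul h2).add h3
  rw [add_zero, add_zero, mul_one] at h4
  refine h4.congr' ?_
  filter_upwards [eventually_ne_atTop 0] with n hn
  have hn' : (n : ℝ) ≠ 0 := by exact_mod_cast hn
  have hn1 : (n : ℝ) + 1 ≠ 0 := by positivity
  simp only [Function.comp_apply, Finset.sum_range_succ' _ n]
  push_cast
  field_simp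
  ring

/-- Applied to sojourn times, this makes departures grow at the same rate as arrivals. -/
lemma tendsto_div_of_average {u : ℕ → ℝ} {L : ℝ}
    (h : Tendsto (fun n : ℕ => (∑ k ∈ Finset.range n, u k) / n) atTop (𝓝 L)) :
    Tendsto (fun n : ℕ => u n / n) atTop (𝓝 0) := by
  have h1 := (tendsto_average_shift h (u 0)).sub h
  rw [sub_self] at h1
  refine h1.congr fun n => ?_
  rw [← sub_div, add_comm (u 0), ← Finset.sum_range_succ', Finset.sum_range_succ]
  ring

section PathLimits

variable {w₀ a₀ : ℝ} {i x : ℕ → ℝ}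

lemma hasPeakAge (ha : 0 ≤ a₀) (hi : ∀ k, 0 < i k) (hx : ∀ k, 0 < x k) {τ m : ℝ}
    (hm : Tendsto (fun n : ℕ => (∑ k ∈ Finset.range n, i k) / n) atTop (𝓝 m))
    (hτ : Tendsto (fun n : ℕ => (∑ k ∈ Finset.range n,
      sojourn w₀ (fun n => (i n, x n)) (k + 1)) / n) atTop (𝓝 τ)) :
    HasPeakAge w₀ a₀ i x (τ + m) := by
  have h := hτ.add hm
  simp_rw [← add_div, ← Finset.sum_add_distrib] at h
  have h1 := (tendsto_average_shift h (peak w₀ a₀ i x 0))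
  have h2 : Tendsto (fun n : ℕ => (∑ k ∈ Finset.range (n + 1), peak w₀ a₀ i x k) / n) atTop
      (𝓝 (τ + m)) := by
    refine h1.congr fun n => ?_
    rw [Finset.sum_range_succ', add_comm]
    simp_rw [peak_succ ha hi hx]
  have h3 : Tendsto (fun n : ℕ => (n : ℝ) / ((n : ℝ) + 1)) atTop (𝓝 1) :=
    tendsto_natCast_div_add_atTop (1 : ℝ)
  have h4 := h2.mul h3
  rw [mul_one] at h4
  refine (tendsto_add_atTop_iff_nat 1).1 (h4.congr' ?_)
  filter_upwards [eventually_ne_atTop 0] with n hn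
  have hn' : (n : ℝ) ≠ 0 := by exact_mod_cast hn
  push_cast
  field_simp

lemma hasAverageAge (ha : 0 ≤ a₀) (hi : ∀ k, 0 < i k) (hx : ∀ k, 0 < x k) {τ m β : ℝ}
    (hmpos : 0 < m)
    (hm : Tendsto (fun n : ℕ => (∑ k ∈ Finset.range n, i k) / n) atTop (𝓝 m))
    (hτ : Tendsto (fun n : ℕ => (∑ k ∈ Finset.range n,
      sojourn w₀ (fun n => (i n, x n)) (k + 1)) / n) atTop (𝓝 τ))
    (hβ : Tendsto (fun n : ℕ => (∑ k ∈ Finset.range n,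
      area (sojourn w₀ (fun n => (i n, x n)) k) (i k, x k)) / n) atTop (𝓝 β)) :
    HasAverageAge w₀ a₀ i x (β / m) := by
  have hDlim : Tendsto (fun n : ℕ => departure w₀ i x n / n) atTop (𝓝 m) := by
    have h1 := (tendsto_average_shift hm (i 0)).add (tendsto_div_of_average hτ)
    rw [add_zero] at h1
    refine h1.congr fun n => ?_
    rw [departure_eq, arrival, Finset.sum_range_succ']
    ring
  have hDtop : Tendsto (departure w₀ i x) atTop atTop := by
    refine (hDlim.pos_mul_atTop hmpos tendsto_natCast_atTop_atTop).congr' ?_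
    filter_upwards [eventually_ne_atTop 0] with n hn
    exact div_mul_cancel₀ _ (by exact_mod_cast hn)
  have hint : ∀ T : ℝ, 0 ≤ T → IntervalIntegrable (age w₀ a₀ i x) volume 0 T := by
    intro T hT
    obtain ⟨n, hn⟩ := (hDtop.eventually_ge_atTop T).exists
    refine (intervalIntegrable_age_departure ha hi hx n).mono_set ?_
    rw [Set.uIcc_of_le hT, Set.uIcc_of_le (hT.trans hn)]
    exact Set.Icc_subset_Icc_right hn
  refine ⟨hint, ?_⟩
  simp_rw [one_div_mul_eq_div]
  refine tendsto_div_of_epochs (D := departure w₀ i x) hmpos (fun t ht => ?_)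
    (fun s t hs hst => ?_) (departure_pos hi hx 0) (strictMono_departure hx).monotone hDlim ?_
  · exact intervalIntegral.integral_nonneg ht fun r hr => age_nonneg ha hx hr.1
  · have hst' : IntervalIntegrable (age w₀ a₀ i x) volume s t :=
      (hint s hs).symm.trans (hint t (hs.trans hst))
    rw [← intervalIntegral.integral_add_adjacent_intervals (hint s hs) hst']
    exact le_add_of_nonneg_right (intervalIntegral.integral_nonneg hst
      fun r hr => age_nonneg ha hx (hs.trans hr.1))
  · exact (tendsto_average_shift hβ _).congr fun n => by rw [integral_age_departure ha hi hx n]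

end PathLimits

end GG1

/-! ### The law of the random input. -/

namespace GG1

open Lindley Shift

section Input

variable {Ω : Type*} [MeasurableSpace Ω] {μ : Measure Ω} {I X : ℕ → Ω → ℝ}

/-- The joint law of an inter-arrival time and a service time. -/
noncomputable def inputLaw (μ : Measure Ω) (I X : ℕ → Ω → ℝ) : Measure (ℝ × ℝ) :=
  (μ.map (I 0)).prod (μ.map (X 0))

lemma IsInput.indepFun (h : IsInput μ I X) (k : ℕ) : IndepFun (I k) (X k) μ :=
  h.indep.indepFun (i := Sum.inl k) (j := Sum.inr k) (by simp)

variable [IsProbabilityMeasure μ]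

lemma IsInput.measurePreserving_pair (h : IsInput μ I X) (k : ℕ) :
    MeasurePreserving (fun ω => (I k ω, X k ω)) μ (inputLaw μ I X) where
  measurable := (h.measurable_interarrival k).prodMk (h.measurable_service k)
  map_eq := by
    rw [(indepFun_iff_map_prod_eq_prod_map_map (h.measurable_interarrival k).aemeasurable
      (h.measurable_service k).aemeasurable).1 (h.indepFun k),
      (h.ident_interarrival k).map_eq, (h.ident_service k).map_eq, inputLaw]

lemma IsInput.isProbabilityMeasure (h : IsInput μ I X) :
    IsProbabilityMeasure (inputLaw μ I X) := by
  rw [← (h.measurePreserving_pair 0).map_eq]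
  exact Measure.isProbabilityMeasure_map (h.measurePreserving_pair 0).measurable.aemeasurable

/-- The input of the queue is an i.i.d. sequence of pairs. -/
lemma IsInput.measurePreserving_seq (h : IsInput μ I X) [IsProbabilityMeasure (inputLaw μ I X)] :
    MeasurePreserving (fun ω k => (I k ω, X k ω)) μ (seqLaw (inputLaw μ I X)) := by
  have hI := fun k => h.measurable_interarrival k
  have hX := fun k => h.measurable_service k
  have hseq : Measurable fun ω k => (I k ω, X k ω) :=
    measurable_pi_lambda _ fun k => (h.measurePreserving_pair k).measurable
  refine ⟨hseq, ?_⟩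
  -- Indexing by ℕ × Bool lets the product law be curried into an i.i.d. sequence of Bool-indexed
  -- families, which are then read as pairs.
  let Y : ℕ × Bool → Ω → ℝ := fun p => bif p.2 then X p.1 else I p.1
  have hY : ∀ p, Measurable (Y p) := by
    rintro ⟨k, _ | _⟩
    exacts [hI k, hX k]
  have hYindep : iIndepFun Y μ := by
    have hinj : Function.Injective fun p : ℕ × Bool =>
        (bif p.2 then Sum.inr p.1 else Sum.inl p.1 : ℕ ⊕ ℕ) := by
      rintro ⟨j, _ | _⟩ ⟨k, _ | _⟩ <;> simp
    convert h.indep.precomp hinj using 1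
    funext ⟨k, b⟩
    cases b <;> rfl
  have hprob : ∀ p, IsProbabilityMeasure (μ.map (Y p)) := fun p =>
    Measure.isProbabilityMeasure_map (hY p).aemeasurable
  have hlaw := hYindep.map_fun_eq_infinitePi_map hY
  let ρ : Bool → Measure ℝ := fun b => bif b then μ.map (X 0) else μ.map (I 0)
  have hρ : ∀ p : ℕ × Bool, μ.map (Y p) = ρ p.2 := by
    rintro ⟨k, _ | _⟩
    exacts [(h.ident_interarrival k).map_eq, (h.ident_service k).map_eq]
  have hρprob : ∀ b, IsProbabilityMeasure (ρ b) := fun b => hρ (0, b) ▸ hprob (0, b)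
  have hpair : Measurable fun v : Bool → ℝ => (v false, v true) := by fun_prop
  have hcurry := Measure.infinitePi_map_curry (fun (_ : ℕ) (b : Bool) => ρ b)
  have hpi := Measure.infinitePi_map_pi (μ := fun _ : ℕ => Measure.infinitePi ρ)
    (f := fun _ v => (v false, v true)) fun _ => hpair
  rw [Measure.infinitePi_map_eval_prod (P := ρ) (by decide)] at hpi
  change _ = Measure.infinitePi fun _ : ℕ => ρ false |>.prod (ρ true)
  have hpairs : Measurable fun (v : ℕ → Bool → ℝ) k => (v k false, v k true) := by fun_prop
  rw [← hpi, ← hcurry, ← funext hρ, ← hlaw, Measure.map_map hpairs (by fun_prop),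
    Measure.map_map (hpairs.comp (MeasurableEquiv.measurable _)) (by fun_prop)]
  rfl

lemma IsInput.integral_inputLaw (h : IsInput μ I X) {f : ℝ × ℝ → ℝ} (hf : Measurable f) :
    ∫ e, f e ∂(inputLaw μ I X) = ∫ ω, f (I 0 ω, X 0 ω) ∂μ :=
  (integral_comp_of_measurePreserving (h.measurePreserving_pair 0) hf).symm

lemma IsInput.isStable (h : IsInput μ I X) (hI2 : MemLp (I 0) 2 μ) (hX2 : MemLp (X 0) 2 μ)
    (hstable : ∫ ω, X 0 ω ∂μ < ∫ ω, I 0 ω ∂μ) : IsStable (inputLaw μ I X) := by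
  have hp := h.measurePreserving_pair 0
  have hae : ∀ {p : ℝ × ℝ → Prop}, MeasurableSet {e | p e} → (∀ᵐ ω ∂μ, p (I 0 ω, X 0 ω)) →
      ∀ᵐ e ∂(inputLaw μ I X), p e := fun hs hω => by
    rw [← hp.map_eq]
    exact (ae_map_iff hp.measurable.aemeasurable hs).2 hω
  refine ⟨hae (measurableSet_lt measurable_const measurable_fst) h.interarrival_pos,
    hae (measurableSet_lt measurable_const measurable_snd) h.service_pos, ?_, ?_, ?_, ?_⟩
  · rw [← hp.map_eq]
    exact (memLp_map_measure_iff measurable_fst.aestronglyMeasurable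
      hp.measurable.aemeasurable).2 hI2
  · rw [← hp.map_eq]
    exact (memLp_map_measure_iff measurable_snd.aestronglyMeasurable
      hp.measurable.aemeasurable).2 hX2
  · rwa [h.integral_inputLaw measurable_fst, h.integral_inputLaw measurable_snd]
  · rw [h.integral_inputLaw measurable_fst, h.integral_inputLaw measurable_snd,
      h.integral_inputLaw (f := fun e => e.1 * e.2) (by fun_prop)]
    exact (h.indepFun 0).integral_fun_mul_eq_mul_integral
      (h.measurable_interarrival 0).aestronglyMeasurable
      (h.measurable_service 0).aestronglyMeasurable

end Input

end GG1

theorem mainTheorem7 {Ω : Type*} [MeasurableSpace Ω] (μ : Measure Ω) [IsProbabilityMeasure μ]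
    (I X : ℕ → Ω → ℝ) (hIX : GG1.IsInput μ I X)
    (hI2 : MemLp (I 0) 2 μ) (hX2 : MemLp (X 0) 2 μ)
    (hstable : ∫ ω, X 0 ω ∂μ < ∫ ω, I 0 ω ∂μ)
    (w₀ a₀ : Ω → ℝ) (hw₀ : ∀ ω, 0 ≤ w₀ ω) (ha₀ : ∀ ω, 0 ≤ a₀ ω)
    (lam : ℝ) (hlam : lam = 1 / ∫ ω, I 0 ω ∂μ) :
    ∃ Aav Ap : ℝ,
      (∀ᵐ ω ∂μ, GG1.HasAverageAge (w₀ ω) (a₀ ω) (fun k => I k ω) (fun k => X k ω) Aav) ∧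
      (∀ᵐ ω ∂μ, GG1.HasPeakAge (w₀ ω) (a₀ ω) (fun k => I k ω) (fun k => X k ω) Ap) ∧
      Ap - 3 * lam * (∫ ω, (I 0 ω) ^ 2 ∂μ) / 2 - lam * (∫ ω, I 0 ω ∂μ) ^ 2 ≤ Aav ∧
      Aav ≤ Ap + lam * (∫ ω, (I 0 ω) ^ 2 ∂μ) / 2 := by
  have := hIX.isProbabilityMeasure
  have hν := hIX.isStable hI2 hX2 hstable
  set ν := GG1.inputLaw μ I X with hνdef
  have hEI : ∫ e, e.1 ∂ν = ∫ ω, I 0 ω ∂μ := hIX.integral_inputLaw measurable_fst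
  have hEX : ∫ e, e.2 ∂ν = ∫ ω, X 0 ω ∂μ := hIX.integral_inputLaw measurable_snd
  have hEI2 : ∫ e, e.1 ^ 2 ∂ν = ∫ ω, I 0 ω ^ 2 ∂μ :=
    hIX.integral_inputLaw (f := fun e => e.1 ^ 2) (by fun_prop)
  have hXnn : 0 ≤ ∫ ω, X 0 ω ∂μ :=
    integral_nonneg_of_ae (hIX.service_pos.mono fun ω h => h.le)
  have hSnn : 0 ≤ ∫ ω, I 0 ω ^ 2 ∂μ := integral_nonneg fun ω => sq_nonneg _
  have hfst : Integrable (fun p : ℝ × (ℝ × ℝ) => p.2.1) ((Lindley.statLaw ν).prod ν) :=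
    hν.integrable_fst.comp_snd (Lindley.statLaw ν)
  have hfstint : ∫ p, p.2.1 ∂((Lindley.statLaw ν).prod ν) = ∫ e, e.1 ∂ν := by
    rw [integral_fun_snd (fun e : ℝ × ℝ => e.1)]; simp
  have hstep : ∫ p, Lindley.step p.1 p.2 ∂((Lindley.statLaw ν).prod ν) =
      ∫ u, u ∂(Lindley.statLaw ν) :=
    Lindley.integral_comp_of_measurePreserving (Lindley.measurePreserving_step hν) measurable_id
  have hle := Lindley.integral_step_mul_le hν
  have hge := Lindley.le_integral_step_mul hν
  have harea := Lindley.integral_area hν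
  have hpath := hIX.measurePreserving_seq.quasiMeasurePreserving.ae
    (hν.ae_pos.and ((Lindley.ae_tendsto_average hν (by fun_prop) hfst).and
      ((Lindley.ae_tendsto_average hν Lindley.measurable_step (Lindley.integrable_step hν)).and
        (Lindley.ae_tendsto_average hν Lindley.measurable_area (Lindley.integrable_area hν)))))
  rw [hfstint, hstep] at hpath
  rw [hEI, hEX] at hle
  rw [hEI, hEI2] at hge
  rw [hEI2] at harea
  rw [hEI] at hpath
  set τ := ∫ u, u ∂(Lindley.statLaw ν)
  set β := ∫ p, Lindley.area p.1 p.2 ∂((Lindley.statLaw ν).prod ν)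
  set m := ∫ ω, I 0 ω ∂μ
  set S := ∫ ω, I 0 ω ^ 2 ∂μ
  have hm : 0 < m := hXnn.trans_lt hstable
  refine ⟨β / m, τ + m, ?_, ?_, ?_, ?_⟩
  · filter_upwards [hpath] with ω ⟨hpos, h1, h2, h3⟩
    exact GG1.hasAverageAge (ha₀ ω) (fun k => (hpos k).1) (fun k => (hpos k).2) hm
      (h1 (w₀ ω)) (h2 (w₀ ω)) (h3 (w₀ ω))
  · filter_upwards [hpath] with ω ⟨hpos, h1, h2, h3⟩
    exact GG1.hasPeakAge (ha₀ ω) (fun k => (hpos k).1) (fun k => (hpos k).2)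
      (h1 (w₀ ω)) (h2 (w₀ ω))
  -- After clearing m the claim is τm - 3S/2 ≤ β, whereas `hge` and `harea` give the stronger τm -
  -- S/2 ≤ β.
  · rw [hlam, le_div_iff₀ hm]
    field_simp
    nlinarith
  -- Here β ≤ τm + m E[X] + S/2, and stability replaces m E[X] by m².
  · rw [hlam, div_le_iff₀ hm]
    field_simp
    nlinarith [mul_pos hm (sub_pos.2 hstable)]
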